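/- Let $n,k\ge 1$ and $0\le q<p\le 1$. Under $\mathbb P_{\mathrm{SBM}(p,q)}$, the labels $z_1,\dots,z_n$ are i.i.d. uniform on $\{1,\dots,k\}$, the matrix $M$ is given by $M_{ii}=0$ and $M_{ij}=p\,\mathbf 1(z_i=z_j)+q\,\mathbf 1(z_i\ne z_j)$ for $i\neq j$, and, given $M$, one observes the symmetric adjacency matrix $A\in\{0,1\}^{n\times n}$ with $A_{ii}=0$ and independent $A_{ij}=A_{ji}\sim\mathrm{Bern}(M_{ij})$ for $i<j$. The membership matrix $Z_M$ is given by $(Z_M)_{ii}=0$ and $(Z_M)_{ij}=\mathbf 1(z_i=z_j)$ for $i\ne j$, and the loss is $\ell(\widehat Z,Z)=\binom n2^{-1}\sum_{1\le i<j\le n}(\widehat Z_{ij}-Z_{ij})^2$. An SDP estimator is a map $A\mapsto\widehat Z$ that returns, for each adjacency matrix $A$, a maximizer of $$\Big\langle Z,\;A-\tfrac{p+q}{2}\mathbf 1_n\mathbf 1_n^\top\Big\rangle\quad\text{subject to}\quad Z\succeq 0,\quad Z_{ij}=Z_{ji}\ge 0\ (1\le i<j\le n),\quad Z_{ii}=1\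 (1\le i\le n).$$ **Proposition.** Let $\epsilon>0$. (i) There are a constant $c>0$ and an integer $N$, depending only on $\epsilon$, such that for all $n\ge N$, all $k\ge1$, all $p,q$ with $\epsilon\le q<p\le 1-\epsilon$, and every SDP estimator $\widehat Z$, $$\mathbb E_{A,M\sim\mathbb P_{\mathrm{SBM}(p,q)}}\big(\ell(\widehat Z,Z_M)\big)\le c\sqrt{\frac{p}{n(p-q)^2}}.$$ (ii) Consequently, nontrivial community detection, that is, expected loss $\ll 1/k$, is achieved whenever $\frac{n(p-q)^2}{pk^2}\gg1$: for every $\delta>0$ there is a constant $C>0$, depending only on $\epsilon$ and $\delta$, such that for all $n,k\ge1$ and all $p,q$ with $\epsilon\le q<p\le1-\epsilon$ and $\frac{n(p-q)^2}{pk^2}\ge C$, every SDP estimator $\widehat Z$ satisfies $\mathbb E_{A,M\sim\mathbb P_{\mathrm{SBM}(p,q)}}\big(\ell(\widehat Z,Z_M)\big)\le \delta/k$. -/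

import Mathlib

open MeasureTheory ProbabilityTheory

noncomputable section

namespace SBM

/-- A simple undirected graph on the vertex set `Fin n`, recorded by its edge indicators: for every
pair `i < j`, whether `{i, j}` is an edge. -/
abbrev EdgeConfig (n : ℕ) : Type := {e : Fin n × Fin n // e.1 < e.2} → Bool

/-- The adjacency matrix (symmetric, with entries in `{0, 1}` and zero diagonal) of a graph. -/
def adjacencyMatrix {n : ℕ} (ω : EdgeConfig n) : Matrix (Fin n) (Fin n) ℝ :=
  Matrix.of fun i j =>
    if h : i < j then (if ω ⟨(i, j), h⟩ = true then 1 else 0)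
    else if h : j < i then (if ω ⟨(j, i), h⟩ = true then 1 else 0)
    else 0

/-- The connectivity matrix `M` with community labels `z`: `M i i = 0`, and for `i ≠ j`,
`M i j = p` if `z i = z j`, and `M i j = q` otherwise. -/
def connectivityMatrix {n k : ℕ} (p q : unitInterval) (z : Fin n → Fin k) :
    Matrix (Fin n) (Fin n) unitInterval :=
  Matrix.of fun i j => if i = j then 0 else if z i = z j then p else q

/-- The membership matrix `Z` of the community labels `z`: `Z i i = 0`, and for `i ≠ j`,
`Z i j = 1` if `z i = z j`, and `Z i j = 0` otherwise. -/
def membershipMatrix {n k : ℕ} (z : Fin n → Fin k) : Matrix (Fin n) (Fin n) ℝ :=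
  Matrix.of fun i j => if i = j then 0 else if z i = z j then 1 else 0

/-- The labels are independent and uniform on the `k` communities. -/
def labelLaw (n k : ℕ) : Measure (Fin n → Fin k) :=
  Measure.pi fun _ => uniformOn Set.univ

/-- The law of the graph given `M`: independently for all `i < j`, the edge `{i, j}` is present
with probability `M i j`. -/
def graphLaw {n : ℕ} (M : Matrix (Fin n) (Fin n) unitInterval) : Measure (EdgeConfig n) :=
  Measure.pi fun e => bernoulliMeasure true false (M e.1.1 e.1.2)

/-- The joint law of the labels and the graph in the stochastic block model. -/
def sbmLaw (n k : ℕ) (p q : unitInterval) : Measure ((Fin n → Fin k) × EdgeConfig n) :=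
  labelLaw n k ⊗ₘ Kernel.ofFunOfCountable fun z => graphLaw (connectivityMatrix p q z)

/-- The loss `ℓ(Z', Z)`: the average of `(Z' i j - Z i j) ^ 2` over all pairs `i < j`. -/
def loss {n : ℕ} (Z' Z : Matrix (Fin n) (Fin n) ℝ) : ℝ :=
  1 / (n.choose 2 : ℝ) * ∑ i, ∑ j ∈ Finset.Ioi i, (Z' i j - Z i j) ^ 2

/-- The expected loss, under the stochastic block model, of an estimator of the membership matrix
that is computed from the adjacency matrix. -/
def expectedLoss (n k : ℕ) (p q : unitInterval)
    (Zhat : Matrix (Fin n) (Fin n) ℝ → Matrix (Fin n) (Fin n) ℝ) : ℝ :=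
  ∫ x, loss (Zhat (adjacencyMatrix x.2)) (membershipMatrix x.1) ∂(sbmLaw n k p q)

/-- The objective `⟨Z, A - ((p + q) / 2) 1 1ᵀ⟩` of the semidefinite program. -/
def sdpObjective {n : ℕ} (p q : ℝ) (A Z : Matrix (Fin n) (Fin n) ℝ) : ℝ :=
  ∑ i, ∑ j, Z i j * (A i j - (p + q) / 2)

/-- The feasible set of the semidefinite program. -/
def sdpFeasible (n : ℕ) : Set (Matrix (Fin n) (Fin n) ℝ) :=
  {Z | Z.PosSemidef ∧ (∀ i j, i < j → Z i j = Z j i ∧ 0 ≤ Z i j) ∧ ∀ i, Z i i = 1}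

/-- `Z` is an optimal solution of the semidefinite program with data `A`. -/
def IsSDPSolution {n : ℕ} (p q : ℝ) (A Z : Matrix (Fin n) (Fin n) ℝ) : Prop :=
  Z ∈ sdpFeasible n ∧ IsMaxOn (sdpObjective p q A) (sdpFeasible n) Z

/-- `Zhat` is an SDP estimator: for every graph it returns an optimal solution of the program. -/
def IsSDPEstimator {n : ℕ} (p q : ℝ)
    (Zhat : Matrix (Fin n) (Fin n) ℝ → Matrix (Fin n) (Fin n) ℝ) : Prop :=
  ∀ ω : EdgeConfig n, IsSDPSolution p q (adjacencyMatrix ω) (Zhat (adjacencyMatrix ω))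

end SBM

end

/-! Off the diagonal, `M - (p+q)/2` equals `(p-q)/2` inside communities and `-(p-q)/2` across them.
Comparing an SDP optimum `Z` with the feasible cluster matrix `C` therefore gives `(p-q) ∑_{i<j} |Z
- C| ≤ ⟨Z - C, A - M⟩` (`IsSDPSolution.mul_sum_abs_le`). Given the labels, `⟨C, A - M⟩` has mean
zero, so it remains to show `E⟨Z, A - M⟩ = O(n^{3/2})`, although `Z` depends on `A`.

A Gram factorization of `Z` (trace `n`) bounds this pairing by the supremum of the noise quadratic
form over the sphere of radius `√n`. The noise has zero diagonal, so the form is affine in each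
coordinate and a point can be rounded to an integer point without decreasing it. This leaves at most
`64 ^ n` lattice points, each with a sub-Gaussian form of variance proxy of order `n ^ 2`, and an
exponential-moment union bound finishes (`integral_inner_noise_le`). Dividing by `(p-q) * n.choose
2` gives a loss of order `1 / (√n (p-q))`; since `p ≥ ε`, the factor `√p` costs only `1/√ε`. -/

namespace SBM

/-! ### Quadratic forms with zero diagonal and integer rounding -/

/-- The quadratic form of a real matrix. -/
def quadForm {n : ℕ} (W : Matrix (Fin n) (Fin n) ℝ) (x : Fin n → ℝ) : ℝ :=
  ∑ i, ∑ j, W i j * (x i * x j)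

lemma quadForm_smul {n : ℕ} (W : Matrix (Fin n) (Fin n) ℝ) (s : ℝ) (x : Fin n → ℝ) :
    quadForm W (fun i => s * x i) = s ^ 2 * quadForm W x := by
  simp only [quadForm, Finset.mul_sum]
  refine Finset.sum_congr rfl fun i _ => Finset.sum_congr rfl fun j _ => by ring

/-- A quadratic form with zero diagonal is affine in each coordinate. -/
lemma quadForm_add_single {n : ℕ} {W : Matrix (Fin n) (Fin n) ℝ} (hW : ∀ i, W i i = 0)
    (x : Fin n → ℝ) (i : Fin n) (s : ℝ) :
    quadForm W (x + Pi.single i s) =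
      quadForm W x + s * ((∑ j, W i j * x j) + ∑ j, W j i * x j) := by
  have h : ∀ a b, W a b * ((x + Pi.single i s : Fin n → ℝ) a * (x + Pi.single i s : Fin n → ℝ) b) =
      W a b * (x a * x b) + (if a = i then s * (W a b * x b) else 0)
        + (if b = i then s * (W a b * x a) else 0)
        + (if a = i then if b = i then s ^ 2 * W a b else 0 else 0) := by
    intro a b
    simp only [Pi.add_apply, Pi.single_apply]
    split_ifs <;> ring
  simp only [quadForm, h, Finset.sum_add_distrib]
  rw [Finset.sum_comm (f := fun a b => if a = i then s * (W a b * x b) else 0)]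
  simp [hW, Finset.mul_sum, mul_add, add_assoc]

/-- Rounding the coordinates one at a time does not decrease a quadratic form with zero diagonal. -/
lemma exists_int_rounding {n : ℕ} {W : Matrix (Fin n) (Fin n) ℝ} (hW : ∀ i, W i i = 0)
    (x : Fin n → ℝ) :
    ∃ y : Fin n → ℤ, (∀ i, |(y i : ℝ) - x i| ≤ 1) ∧
      quadForm W x ≤ quadForm W (fun i => (y i : ℝ)) := by
  have key : ∀ s : Finset (Fin n), ∃ u : Fin n → ℝ, (∀ i ∈ s, ∃ m : ℤ, u i = m ∧ |(m : ℝ) - x i| ≤ 1) ∧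
      (∀ i ∉ s, u i = x i) ∧ quadForm W x ≤ quadForm W u := by
    intro s
    induction s using Finset.induction_on with
    | empty => exact ⟨x, by simp, by simp, le_rfl⟩
    | insert a s ha ih =>
      obtain ⟨u, hu1, hu2, hu3⟩ := ih
      obtain ⟨m, hm, hle⟩ : ∃ m : ℤ, |(m : ℝ) - x a| ≤ 1 ∧
          quadForm W u ≤ quadForm W (u + Pi.single a ((m : ℝ) - x a)) := by
        -- `b` is the slope in coordinate `a`; its sign decides whether to round up or down.
        set b := (∑ j, W a j * u j) + ∑ j, W j a * u j with hb
        have hfl := Int.floor_le (x a)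
        have hfl' := Int.lt_floor_add_one (x a)
        rcases le_total 0 b with h | h
        · refine ⟨⌊x a⌋ + 1, ?_, ?_⟩
          · push_cast
            rw [abs_le]; constructor <;> linarith
          · rw [quadForm_add_single hW, ← hb]
            push_cast
            have : 0 ≤ ((⌊x a⌋ : ℝ) + 1 - x a) * b := mul_nonneg (by linarith) h
            linarith
        · refine ⟨⌊x a⌋, ?_, ?_⟩
          · rw [abs_le]; constructor <;> linarith
          · rw [quadForm_add_single hW, ← hb]
            have : 0 ≤ ((⌊x a⌋ : ℝ) - x a) * b := mul_nonneg_of_nonpos_of_nonpos (by linarith) h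
            linarith
      refine ⟨_, ?_, ?_, hu3.trans hle⟩
      · intro i hi
        rcases Finset.mem_insert.1 hi with rfl | hi
        · exact ⟨m, by simp [hu2 i ha], hm⟩
        · have : i ≠ a := fun h => ha (h ▸ hi)
          obtain ⟨m', h1, h2⟩ := hu1 i hi
          exact ⟨m', by simp [this, h1], h2⟩
      · intro i hi
        rw [Finset.mem_insert, not_or] at hi
        simp [hi.1, hu2 i hi.2]
  obtain ⟨u, hu1, -, hu3⟩ := key Finset.univ
  choose y hy1 hy2 using fun i => hu1 i (Finset.mem_univ i)
  refine ⟨y, hy2, ?_⟩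
  rwa [← funext hy1]

/-! ### Lattice points as a discretization of the sphere -/

/-- The integer points of the Euclidean ball of radius `2 √n` in dimension `n`. -/
noncomputable def latticePoints (n : ℕ) : Finset (Fin n → ℤ) :=
  (Fintype.piFinset fun _ => Finset.Icc (-(4 * n : ℤ)) (4 * n)).filter
    fun y => ∑ i, y i ^ 2 ≤ 4 * n

/-- The box serves only finiteness: integers satisfy `|y i| ≤ y i ^ 2 ≤ 4 n`. -/
lemma mem_latticePoints {n : ℕ} {y : Fin n → ℤ} :
    y ∈ latticePoints n ↔ ∑ i, y i ^ 2 ≤ 4 * n := by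
  refine ⟨fun h => (Finset.mem_filter.1 h).2, fun h => Finset.mem_filter.2 ⟨?_, h⟩⟩
  refine Fintype.mem_piFinset.2 fun i => Finset.mem_Icc.2 ?_
  have h1 : y i ^ 2 ≤ 4 * n :=
    (Finset.single_le_sum (f := fun i => y i ^ 2) (fun _ _ => sq_nonneg _)
      (Finset.mem_univ i)).trans h
  have h2 : |y i| ≤ y i ^ 2 := by
    rw [← Int.natCast_natAbs]; exact Int.natAbs_le_self_sq _
  exact abs_le.1 (h2.trans h1)

lemma sum_latticePoints_sq_le {n : ℕ} {y : Fin n → ℤ} (hy : y ∈ latticePoints n) :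
    ∑ i, (y i : ℝ) ^ 2 ≤ 4 * n := by
  exact_mod_cast mem_latticePoints.1 hy

lemma sum_half_pow_natAbs_le (s : Finset ℤ) : ∑ m ∈ s, (1 / 2 : ℝ) ^ m.natAbs ≤ 4 := by
  have h : HasSum (fun m : ℤ => (1 / 2 : ℝ) ^ m.natAbs) (2 + 2 - (1 / 2) ^ (0 : ℤ).natAbs) := by
    apply HasSum.of_nat_of_neg
    · simpa using hasSum_geometric_two
    · simpa using hasSum_geometric_two
  calc _ ≤ _ := sum_le_hasSum s (fun _ _ => by positivity) h
    _ ≤ 4 := by norm_num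

/-- Since `∑ |y i| ≤ ∑ y i ^ 2 ≤ 4 n`, each point has weight at least 1 under `2 ^ (4n) ∏ 2 ^ (-|y
i|)`. This weight factorizes over coordinates, with total at most `16 ^ n * 4 ^ n`. -/
lemma card_latticePoints_le (n : ℕ) : ((latticePoints n).card : ℝ) ≤ 64 ^ n := by
  have h1 : ∀ y ∈ latticePoints n, (1 : ℝ) ≤ 2 ^ (4 * n) * ∏ i, (1 / 2 : ℝ) ^ (y i).natAbs := by
    intro y hy
    rw [Finset.prod_pow_eq_pow_sum]
    have : ∑ i, (y i).natAbs ≤ 4 * n := by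
      have h := mem_latticePoints.1 hy
      have h2 : ∑ i, ((y i).natAbs : ℤ) ≤ ∑ i, y i ^ 2 :=
        Finset.sum_le_sum fun i _ => Int.natAbs_le_self_sq (y i)
      exact_mod_cast h2.trans h
    calc (1 : ℝ) = 2 ^ (4 * n) * (1 / 2) ^ (4 * n) := by rw [← mul_pow]; norm_num
      _ ≤ _ := by
        gcongr ?_ * ?_
        exact pow_le_pow_of_le_one (by norm_num) (by norm_num) this
  calc ((latticePoints n).card : ℝ) = ∑ y ∈ latticePoints n, 1 := by simp
    _ ≤ ∑ y ∈ latticePoints n, 2 ^ (4 * n) * ∏ i, (1 / 2 : ℝ) ^ (y i).natAbs :=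
      Finset.sum_le_sum h1
    _ ≤ ∑ y ∈ Fintype.piFinset fun _ : Fin n => Finset.Icc (-(4 * n : ℤ)) (4 * n),
          2 ^ (4 * n) * ∏ i, (1 / 2 : ℝ) ^ (y i).natAbs :=
      Finset.sum_le_sum_of_subset_of_nonneg (Finset.filter_subset _ _)
        fun _ _ _ => by positivity
    _ = 2 ^ (4 * n) * ∏ _i : Fin n, ∑ m ∈ Finset.Icc (-(4 * n : ℤ)) (4 * n),
          (1 / 2 : ℝ) ^ m.natAbs := by
      rw [← Finset.mul_sum, Finset.prod_univ_sum]
    _ ≤ 2 ^ (4 * n) * ∏ _i : Fin n, 4 := by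
      gcongr
      exact sum_half_pow_natAbs_le _
    _ = 64 ^ n := by
      rw [pow_mul, Finset.prod_const, Finset.card_univ, Fintype.card_fin, ← mul_pow]
      norm_num

/-- A bound for a quadratic form with zero diagonal on lattice points gives a bound everywhere. -/
lemma quadForm_le_of_latticePoints {n : ℕ} {W : Matrix (Fin n) (Fin n) ℝ} (hW : ∀ i, W i i = 0)
    {S : ℝ} (hS : ∀ y ∈ latticePoints n, quadForm W (fun i => (y i : ℝ)) ≤ S) (x : Fin n → ℝ) :
    n * quadForm W x ≤ (∑ i, x i ^ 2) * S := by
  rcases (Finset.sum_nonneg fun i (_ : i ∈ Finset.univ) => sq_nonneg (x i)).eq_or_lt with h0 | hpos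
  · have hx : ∀ i, x i = 0 := by
      intro i
      have := (Finset.sum_eq_zero_iff_of_nonneg fun i _ => sq_nonneg (x i)).1 h0.symm i
        (Finset.mem_univ i)
      simpa using this
    simp [quadForm, hx]
  · set r := ∑ i, x i ^ 2 with hr
    -- This scales `x` to squared norm `n`. Rounding moves each coordinate by at most 1, so the
    -- squared norm becomes at most `2 n + 2 n`.
    set s := √(n / r) with hs
    have hs2 : s ^ 2 = n / r := Real.sq_sqrt (by positivity)
    obtain ⟨y, hy1, hy2⟩ := exists_int_rounding hW (fun i => s * x i)
    have hy : y ∈ latticePoints n := by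
      rw [mem_latticePoints]
      have : ∑ i, (y i : ℝ) ^ 2 ≤ 4 * n := by
        calc ∑ i, (y i : ℝ) ^ 2 ≤ ∑ i, (2 * (s ^ 2 * x i ^ 2) + 2) := by
              refine Finset.sum_le_sum fun i _ => ?_
              have h1 := sq_le_one_iff_abs_le_one _ |>.2 (hy1 i)
              nlinarith [sq_nonneg ((y i : ℝ) - 2 * (s * x i))]
          _ = 2 * (s ^ 2 * r) + 2 * n := by
              rw [Finset.sum_add_distrib, ← Finset.mul_sum, ← Finset.mul_sum, ← hr]
              simp [mul_comm]
          _ = 4 * n := by rw [hs2]; field_simp; ring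
      exact_mod_cast this
    have h := hy2.trans (hS y hy)
    rw [quadForm_smul, hs2, div_mul_eq_mul_div, div_le_iff₀ hpos] at h
    linarith

/-! ### Gram factorization and the elliptope -/

open scoped MatrixOrder in
lemma exists_gram_of_posSemidef {n : ℕ} {Z : Matrix (Fin n) (Fin n) ℝ} (hZ : Z.PosSemidef) :
    ∃ B : Matrix (Fin n) (Fin n) ℝ, ∀ i j, Z i j = ∑ l, B l i * B l j := by
  obtain ⟨X, hX, -, rfl⟩ :=
    CFC.exists_sqrt_of_isSelfAdjoint_of_quasispectrumRestricts hZ.isHermitian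
      (QuasispectrumRestricts.nnreal_of_nonneg hZ.nonneg)
  refine ⟨X, fun i j => ?_⟩
  have h : X i = fun l => X l i := by
    funext l
    simpa using (hX.star_eq.symm ▸ rfl : X i l = star X i l)
  simp [Matrix.mul_apply, h]

/-- With `Z = Bᵀ B`, the pairing is the sum of the forms at the rows of `B`, whose squared norms add
up to the trace `n`. -/
lemma sum_mul_le_of_posSemidef {n : ℕ} {W Z : Matrix (Fin n) (Fin n) ℝ} (hW : ∀ i, W i i = 0)
    {S : ℝ} (hS : ∀ y ∈ latticePoints n, quadForm W (fun i => (y i : ℝ)) ≤ S)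
    (hZ : Z.PosSemidef) (hZ1 : ∀ i, Z i i = 1) (hn : 1 ≤ n) :
    ∑ i, ∑ j, Z i j * W i j ≤ S := by
  obtain ⟨B, hB⟩ := exists_gram_of_posSemidef hZ
  have hn' : (0 : ℝ) < n := by exact_mod_cast hn
  have h1 : ∑ i, ∑ j, Z i j * W i j = ∑ l, quadForm W (B l) := by
    simp only [hB, quadForm, Finset.sum_mul]
    rw [Finset.sum_comm (f := fun l i => ∑ j, W i j * (B l i * B l j))]
    refine Finset.sum_congr rfl fun i _ => ?_
    rw [Finset.sum_comm]
    refine Finset.sum_congr rfl fun l _ => Finset.sum_congr rfl fun j _ => by ring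
  have h2 : ∑ l, ∑ i, B l i ^ 2 = n := by
    rw [Finset.sum_comm]
    have : ∀ i, ∑ l, B l i ^ 2 = 1 := fun i => by
      rw [← hZ1 i, hB]; simp [pow_two]
    simp [this]
  have h3 : n * ∑ l, quadForm W (B l) ≤ n * S := by
    rw [Finset.mul_sum, ← h2, Finset.sum_mul, h2]
    exact Finset.sum_le_sum fun l _ => quadForm_le_of_latticePoints hW hS (B l)
  rw [h1]
  exact le_of_mul_le_mul_left h3 hn'

lemma entry_le_one_of_posSemidef {n : ℕ} {Z : Matrix (Fin n) (Fin n) ℝ}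
    (hZ : Z.PosSemidef) (hZ1 : ∀ i, Z i i = 1) (i j : Fin n) : Z i j ≤ 1 := by
  obtain ⟨B, hB⟩ := exists_gram_of_posSemidef hZ
  have h : 2 * ∑ l, B l i * B l j ≤ ∑ l, B l i * B l i + ∑ l, B l j * B l j := by
    rw [Finset.mul_sum, ← Finset.sum_add_distrib]
    exact Finset.sum_le_sum fun l _ => by nlinarith [sq_nonneg (B l i - B l j)]
  rw [← hB, ← hB, ← hB, hZ1, hZ1] at h
  linarith

/-! ### Sums over pairs and the adjacency matrix -/

lemma sum_Ioi_eq_sum_subtype {n : ℕ} (f : Fin n → Fin n → ℝ) :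
    ∑ i, ∑ j ∈ Finset.Ioi i, f i j = ∑ e : {e : Fin n × Fin n // e.1 < e.2}, f e.1.1 e.1.2 := by
  rw [← Finset.sum_subtype (Finset.univ.filter fun e : Fin n × Fin n => e.1 < e.2) (by simp)
    (fun e : Fin n × Fin n => f e.1 e.2), Finset.sum_filter, Fintype.sum_prod_type]
  refine Finset.sum_congr rfl fun i _ => ?_
  rw [← Finset.sum_filter]
  congr 1
  ext j; simp

lemma sum_sum_eq_two_mul_sum_Ioi {n : ℕ} {f : Fin n → Fin n → ℝ} (hf : ∀ i j, f i j = f j i)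
    (hf0 : ∀ i, f i i = 0) : ∑ i, ∑ j, f i j = 2 * ∑ i, ∑ j ∈ Finset.Ioi i, f i j := by
  have h : ∀ i j, f i j = (if i < j then f i j else 0) + (if j < i then f j i else 0) := by
    intro i j
    rcases lt_trichotomy i j with h | rfl | h
    · simp [h, h.not_gt]
    · simp [hf0]
    · simp [h, h.not_gt, hf i j]
  have h2 : ∀ i, ∑ j ∈ Finset.Ioi i, f i j = ∑ j, if i < j then f i j else 0 := by
    intro i
    rw [← Finset.sum_filter]
    congr 1
    ext j; simp
  simp only [h2]
  calc ∑ i, ∑ j, f i j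
      = ∑ i, ∑ j, ((if i < j then f i j else 0) + (if j < i then f j i else 0)) :=
        Finset.sum_congr rfl fun i _ => Finset.sum_congr rfl fun j _ => h i j
    _ = _ := by
      simp only [Finset.sum_add_distrib]
      rw [Finset.sum_comm (f := fun i j => if j < i then f j i else 0), two_mul]

lemma adjacencyMatrix_symm {n : ℕ} (ω : EdgeConfig n) (i j : Fin n) :
    adjacencyMatrix ω i j = adjacencyMatrix ω j i := by
  rcases lt_trichotomy i j with h | rfl | h
  · simp [adjacencyMatrix, h, h.not_gt]
  · rfl
  · simp [adjacencyMatrix, h, h.not_gt]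

lemma adjacencyMatrix_self {n : ℕ} (ω : EdgeConfig n) (i : Fin n) :
    adjacencyMatrix ω i i = 0 := by
  simp [adjacencyMatrix]

lemma adjacencyMatrix_of_lt {n : ℕ} (ω : EdgeConfig n) {i j : Fin n} (h : i < j) :
    adjacencyMatrix ω i j = if ω ⟨(i, j), h⟩ = true then 1 else 0 := by
  simp [adjacencyMatrix, h]

/-! ### The noise and its exponential moments -/

/-- The noise `A - M`. -/
noncomputable def noise {n : ℕ} (M : Matrix (Fin n) (Fin n) unitInterval) (ω : EdgeConfig n) :
    Matrix (Fin n) (Fin n) ℝ :=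
  Matrix.of fun i j => adjacencyMatrix ω i j - (M i j : ℝ)

instance {n : ℕ} (M : Matrix (Fin n) (Fin n) unitInterval) :
    IsProbabilityMeasure (graphLaw M) := by
  unfold graphLaw; infer_instance

/-- Hoeffding's lemma: a variable with values in `[0, 1]` has variance proxy `1/4`. -/
lemma integral_exp_bernoulli_le (m : unitInterval) (s : ℝ) :
    ∫ b, Real.exp (s * ((if b = true then 1 else 0) - (m : ℝ)))
      ∂(bernoulliMeasure true false m) ≤ Real.exp (s ^ 2 / 8) := by
  have h := hasSubgaussianMGF_of_mem_Icc (μ := bernoulliMeasure true false m) (a := 0) (b := 1)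
    (X := fun b : Bool => if b = true then (1 : ℝ) else 0) (measurable_of_countable _).aemeasurable
    (Filter.Eventually.of_forall fun b => by cases b <;> simp)
  have hE : ∫ b, (if b = true then (1 : ℝ) else 0) ∂(bernoulliMeasure true false m) = m := by
    rw [integral_bernoulliMeasure]
    simp
  have := h.mgf_le s
  rw [hE] at this
  refine this.trans (Real.exp_le_exp.2 (le_of_eq ?_))
  simp
  ring

lemma integral_noise_bernoulli (m : unitInterval) :
    ∫ b, ((if b = true then 1 else 0) - (m : ℝ)) ∂(bernoulliMeasure true false m) = 0 := by
  rw [integral_bernoulliMeasure]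
  simp
  ring

/-- The exponential moments of linear statistics of the noise. -/
lemma integral_exp_sum_noise_le {n : ℕ} (M : Matrix (Fin n) (Fin n) unitInterval)
    (a : Fin n → Fin n → ℝ) :
    ∫ ω, Real.exp (∑ i, ∑ j ∈ Finset.Ioi i, a i j * noise M ω i j) ∂(graphLaw M) ≤
      Real.exp ((∑ i, ∑ j ∈ Finset.Ioi i, a i j ^ 2) / 8) := by
  have h : ∀ ω : EdgeConfig n, Real.exp (∑ i, ∑ j ∈ Finset.Ioi i, a i j * noise M ω i j) =
      ∏ e : {e : Fin n × Fin n // e.1 < e.2},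
        Real.exp (a e.1.1 e.1.2 * ((if ω e = true then 1 else 0) - (M e.1.1 e.1.2 : ℝ))) := by
    intro ω
    rw [sum_Ioi_eq_sum_subtype, Real.exp_sum]
    refine Finset.prod_congr rfl fun e _ => ?_
    simp [noise, adjacencyMatrix_of_lt ω e.2]
  simp only [h]
  rw [graphLaw, integral_fintype_prod_eq_prod (f := fun (e : {e : Fin n × Fin n // e.1 < e.2})
    (b : Bool) => Real.exp (a e.1.1 e.1.2 * ((if b = true then 1 else 0) - (M e.1.1 e.1.2 : ℝ)))),
    sum_Ioi_eq_sum_subtype, Finset.sum_div, Real.exp_sum]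
  exact Finset.prod_le_prod (fun _ _ => integral_nonneg fun _ => (Real.exp_pos _).le)
    fun e _ => integral_exp_bernoulli_le _ _

lemma integrable_graphLaw {n : ℕ} (M : Matrix (Fin n) (Fin n) unitInterval)
    (f : EdgeConfig n → ℝ) : Integrable f (graphLaw M) := .of_finite

lemma integral_noise {n : ℕ} (M : Matrix (Fin n) (Fin n) unitInterval) {i j : Fin n}
    (hij : i < j) : ∫ ω, noise M ω i j ∂(graphLaw M) = 0 := by
  have h : ∀ ω, noise M ω i j =
      (fun b : Bool => (if b = true then (1 : ℝ) else 0) - (M i j : ℝ)) (ω ⟨(i, j), hij⟩) := by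
    intro ω
    simp [noise, adjacencyMatrix_of_lt ω hij]
  simp only [h]
  refine (integral_comp_eval (μ := fun e : {e : Fin n × Fin n // e.1 < e.2} =>
      bernoulliMeasure true false (M e.1.1 e.1.2)) (i := (⟨(i, j), hij⟩ : {e : Fin n × Fin n // e.1 < e.2}))
    (f := fun b : Bool => (if b = true then (1 : ℝ) else 0) - (M i j : ℝ))
    (measurable_of_countable _).aestronglyMeasurable).trans ?_
  exact integral_noise_bernoulli _

lemma noise_symm {n : ℕ} {M : Matrix (Fin n) (Fin n) unitInterval} (hM : ∀ i j, M i j = M j i)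
    (ω : EdgeConfig n) (i j : Fin n) : noise M ω i j = noise M ω j i := by
  simp [noise, adjacencyMatrix_symm ω i j, hM i j]

lemma noise_self {n : ℕ} {M : Matrix (Fin n) (Fin n) unitInterval} (hM : ∀ i, M i i = 0)
    (ω : EdgeConfig n) (i : Fin n) : noise M ω i i = 0 := by
  simp [noise, adjacencyMatrix_self, hM i]

/-- By symmetry each independent edge carries the coefficient `2 t y_i y_j`. The squares sum to at
most `4 t² (4n)²`, and Hoeffding divides this by 8. -/
lemma integral_exp_quadForm_noise_le {n : ℕ} {M : Matrix (Fin n) (Fin n) unitInterval}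
    (hM : ∀ i j, M i j = M j i) (hM0 : ∀ i, M i i = 0) (t : ℝ) {y : Fin n → ℤ}
    (hy : y ∈ latticePoints n) :
    ∫ ω, Real.exp (t * quadForm (noise M ω) (fun i => (y i : ℝ))) ∂(graphLaw M) ≤
      Real.exp (8 * t ^ 2 * n ^ 2) := by
  have h : ∀ ω, t * quadForm (noise M ω) (fun i => (y i : ℝ)) =
      ∑ i, ∑ j ∈ Finset.Ioi i, (2 * t * (y i * y j)) * noise M ω i j := by
    intro ω
    rw [quadForm, sum_sum_eq_two_mul_sum_Ioi]
    · simp only [Finset.mul_sum]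
      exact Finset.sum_congr rfl fun i _ => Finset.sum_congr rfl fun j _ => by ring
    · intro i j; rw [noise_symm hM]; ring
    · intro i; rw [noise_self hM0]; ring
  simp only [h]
  refine (integral_exp_sum_noise_le M _).trans (Real.exp_le_exp.2 ?_)
  have hy2 := sum_latticePoints_sq_le hy
  have h1 : ∑ i, ∑ j ∈ Finset.Ioi i, (2 * t * ((y i : ℝ) * y j)) ^ 2 ≤
      4 * t ^ 2 * (∑ i, (y i : ℝ) ^ 2) ^ 2 := by
    calc _ ≤ ∑ i, ∑ j, (2 * t * ((y i : ℝ) * y j)) ^ 2 :=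
          Finset.sum_le_sum fun i _ => Finset.sum_le_sum_of_subset_of_nonneg
            (Finset.subset_univ _) fun _ _ _ => sq_nonneg _
      _ = _ := by
        rw [pow_two (∑ i, (y i : ℝ) ^ 2), Finset.sum_mul_sum, Finset.mul_sum]
        refine Finset.sum_congr rfl fun i _ => ?_
        rw [Finset.mul_sum]
        exact Finset.sum_congr rfl fun j _ => by ring
  have h2 : (∑ i, (y i : ℝ) ^ 2) ^ 2 ≤ (4 * n) ^ 2 :=
    pow_le_pow_left₀ (Finset.sum_nonneg fun _ _ => sq_nonneg _) hy2 2
  have := mul_le_mul_of_nonneg_left h2 (by positivity : 0 ≤ 4 * t ^ 2)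
  linarith

/-- The tangent line of `exp` at `log a`. It is linear in `exp x`, so it can be integrated and takes
the place of Jensen's inequality. -/
lemma le_log_add_exp_div {x a : ℝ} (ha : 0 < a) : x ≤ Real.log a - 1 + Real.exp x / a := by
  have := Real.add_one_le_exp (x - Real.log a)
  rw [Real.exp_sub, Real.exp_log ha] at this
  linarith

/-- The expected value of `⟨Z, A - M⟩` for an estimator `Z` with values in the elliptope. -/
lemma integral_inner_noise_le {n : ℕ} (hn : 1 ≤ n) {M : Matrix (Fin n) (Fin n) unitInterval}
    (hM : ∀ i j, M i j = M j i) (hM0 : ∀ i, M i i = 0)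
    {Z : EdgeConfig n → Matrix (Fin n) (Fin n) ℝ} (hZ : ∀ ω, (Z ω).PosSemidef)
    (hZ1 : ∀ ω i, Z ω i i = 1) :
    ∫ ω, ∑ i, ∑ j, Z ω i j * noise M ω i j ∂(graphLaw M) ≤
      (Real.log 64 + 8) * (n * √n) := by
  have hn0 : (0 : ℝ) < n := by exact_mod_cast hn
  -- This choice makes the exponent `8 t² n²` equal to `8 n`, the same order as the entropy `n log
  -- 64`.
  set t : ℝ := 1 / √n with ht
  have ht0 : 0 < t := by positivity
  have ht2 : t ^ 2 * n ^ 2 = n := by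
    rw [ht, div_pow, Real.sq_sqrt hn0.le]; field_simp
  set a : ℝ := 64 ^ n * Real.exp (8 * n) with ha
  have ha0 : 0 < a := by positivity
  -- The sum dominates the maximum over lattice points, so the bound on the pairing is uniform in
  -- the data-dependent `Z ω`.
  set G : EdgeConfig n → ℝ := fun ω => ∑ y ∈ latticePoints n,
    Real.exp (t * quadForm (noise M ω) (fun i => (y i : ℝ))) with hG
  have hbound : ∀ ω, t * ∑ i, ∑ j, Z ω i j * noise M ω i j ≤ Real.log a - 1 + G ω / a := by
    intro ω
    rw [← le_div_iff₀' ht0]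
    refine sum_mul_le_of_posSemidef (noise_self hM0 ω) (fun y hy => ?_) (hZ ω) (hZ1 ω) hn
    rw [le_div_iff₀' ht0]
    refine (le_log_add_exp_div ha0).trans ?_
    gcongr
    exact Finset.single_le_sum (f := fun y : Fin n → ℤ =>
      Real.exp (t * quadForm (noise M ω) (fun i => (y i : ℝ)))) (fun _ _ => (Real.exp_pos _).le) hy
  have hGint : ∫ ω, G ω ∂(graphLaw M) ≤ a := by
    rw [hG, integral_finsetSum _ fun _ _ => integrable_graphLaw M _]
    calc _ ≤ ∑ y ∈ latticePoints n, Real.exp (8 * n) :=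
          Finset.sum_le_sum fun y hy =>
            (integral_exp_quadForm_noise_le hM hM0 t hy).trans_eq (by rw [mul_assoc, ht2])
      _ ≤ a := by
        rw [Finset.sum_const, nsmul_eq_mul, ha]
        gcongr
        exact card_latticePoints_le n
  have hint : t * ∫ ω, ∑ i, ∑ j, Z ω i j * noise M ω i j ∂(graphLaw M) ≤ Real.log a := by
    rw [← integral_const_mul]
    calc _ ≤ ∫ ω, (Real.log a - 1 + G ω / a) ∂(graphLaw M) :=
          integral_mono (integrable_graphLaw M _) (integrable_graphLaw M _) hbound
      _ = Real.log a - 1 + (∫ ω, G ω ∂(graphLaw M)) / a := by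
        rw [integral_add (integrable_graphLaw M _) (integrable_graphLaw M _), integral_div]
        simp
      _ ≤ Real.log a := by
        have := (div_le_one ha0).2 hGint
        linarith
  have hlog : Real.log a = n * (Real.log 64 + 8) := by
    rw [ha, Real.log_mul (by positivity) (by positivity), Real.log_pow, Real.log_exp]; ring
  rw [hlog, ht, one_div_mul_eq_div, div_le_iff₀ (by positivity)] at hint
  linarith

/-! ### The cluster matrix and the basic inequality -/

/-- The cluster matrix, with unit diagonal, of the community labels `z`. -/
def clusterMatrix {n k : ℕ} (z : Fin n → Fin k) : Matrix (Fin n) (Fin n) ℝ :=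
  Matrix.of fun i j => if z i = z j then 1 else 0

lemma clusterMatrix_posSemidef {n k : ℕ} (z : Fin n → Fin k) : (clusterMatrix z).PosSemidef := by
  let B : Matrix (Fin k) (Fin n) ℝ := Matrix.of fun c i => if z i = c then 1 else 0
  have h : clusterMatrix z = B.conjTranspose * B := by
    ext i j
    simp [clusterMatrix, B, Matrix.mul_apply, eq_comm]
  rw [h]
  exact Matrix.posSemidef_conjTranspose_mul_self B

lemma clusterMatrix_mem_sdpFeasible {n k : ℕ} (z : Fin n → Fin k) :
    clusterMatrix z ∈ sdpFeasible n := by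
  refine ⟨clusterMatrix_posSemidef z, fun i j _ => ⟨?_, ?_⟩, fun i => by simp [clusterMatrix]⟩
  · simp [clusterMatrix, eq_comm]
  · simp only [clusterMatrix, Matrix.of_apply]; split_ifs <;> norm_num

lemma sdpFeasible_symm {n : ℕ} {Z : Matrix (Fin n) (Fin n) ℝ} (hZ : Z ∈ sdpFeasible n)
    (i j : Fin n) : Z i j = Z j i := by
  simpa using hZ.1.isHermitian.apply j i

lemma sdpFeasible_nonneg {n : ℕ} {Z : Matrix (Fin n) (Fin n) ℝ} (hZ : Z ∈ sdpFeasible n)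
    (i j : Fin n) : 0 ≤ Z i j := by
  rcases lt_trichotomy i j with h | rfl | h
  · exact (hZ.2.1 i j h).2
  · rw [hZ.2.2]; exact zero_le_one
  · rw [sdpFeasible_symm hZ]; exact (hZ.2.1 j i h).2

lemma sdpFeasible_le_one {n : ℕ} {Z : Matrix (Fin n) (Fin n) ℝ} (hZ : Z ∈ sdpFeasible n)
    (i j : Fin n) : Z i j ≤ 1 := entry_le_one_of_posSemidef hZ.1 hZ.2.2 i j

lemma connectivityMatrix_symm {n k : ℕ} (p q : unitInterval) (z : Fin n → Fin k) (i j : Fin n) :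
    connectivityMatrix p q z i j = connectivityMatrix p q z j i := by
  simp [connectivityMatrix, eq_comm]

lemma connectivityMatrix_self {n k : ℕ} (p q : unitInterval) (z : Fin n → Fin k) (i : Fin n) :
    connectivityMatrix p q z i i = 0 := by
  simp [connectivityMatrix]

/-- The basic inequality for an optimal solution of the semidefinite program. -/
lemma IsSDPSolution.mul_sum_abs_le {n k : ℕ} {p q : unitInterval}
    {z : Fin n → Fin k} {ω : EdgeConfig n} {Z : Matrix (Fin n) (Fin n) ℝ}
    (hZ : IsSDPSolution p q (adjacencyMatrix ω) Z) :
    ((p : ℝ) - q) * ∑ i, ∑ j ∈ Finset.Ioi i, |Z i j - clusterMatrix z i j| ≤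
      ∑ i, ∑ j, Z i j * noise (connectivityMatrix p q z) ω i j -
        ∑ i, ∑ j, clusterMatrix z i j * noise (connectivityMatrix p q z) ω i j := by
  have hC := clusterMatrix_mem_sdpFeasible z
  have hobj : sdpObjective p q (adjacencyMatrix ω) (clusterMatrix z) ≤
      sdpObjective p q (adjacencyMatrix ω) Z := hZ.2 hC
  -- As `0 ≤ Z i j ≤ 1`, the sign of `Z - C` is opposite to that of `M - (p+q)/2`, so the signal
  -- part is exactly `-(p-q)/2` times the absolute error. On the diagonal `Z` and `C` agree.
  have hterm : ∀ i j, Z i j * (adjacencyMatrix ω i j - ((p : ℝ) + q) / 2) -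
      clusterMatrix z i j * (adjacencyMatrix ω i j - ((p : ℝ) + q) / 2) =
      (Z i j * noise (connectivityMatrix p q z) ω i j -
        clusterMatrix z i j * noise (connectivityMatrix p q z) ω i j) -
      ((p : ℝ) - q) / 2 * |Z i j - clusterMatrix z i j| := by
    intro i j
    have h0 := sdpFeasible_nonneg hZ.1 i j
    have h1 := sdpFeasible_le_one hZ.1 i j
    by_cases hij : i = j
    · subst hij
      rw [hZ.1.2.2, hC.2.2]; simp
    · by_cases hz : z i = z j
      · have hc : clusterMatrix z i j = 1 := by simp [clusterMatrix, hz]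
        have hm : connectivityMatrix p q z i j = p := by simp [connectivityMatrix, hij, hz]
        rw [hc, abs_of_nonpos (by linarith), noise, Matrix.of_apply, hm]
        ring
      · have hc : clusterMatrix z i j = 0 := by simp [clusterMatrix, hz]
        have hm : connectivityMatrix p q z i j = q := by simp [connectivityMatrix, hij, hz]
        rw [hc, abs_of_nonneg (by linarith), noise, Matrix.of_apply, hm]
        ring
  have hsum : sdpObjective p q (adjacencyMatrix ω) Z -
      sdpObjective p q (adjacencyMatrix ω) (clusterMatrix z) =
      (∑ i, ∑ j, Z i j * noise (connectivityMatrix p q z) ω i j -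
        ∑ i, ∑ j, clusterMatrix z i j * noise (connectivityMatrix p q z) ω i j) -
      ((p : ℝ) - q) / 2 * ∑ i, ∑ j, |Z i j - clusterMatrix z i j| := by
    simp only [sdpObjective, Finset.mul_sum, ← Finset.sum_sub_distrib, hterm]
  rw [sum_sum_eq_two_mul_sum_Ioi (f := fun i j => |Z i j - clusterMatrix z i j|)
    (fun i j => by rw [sdpFeasible_symm hZ.1, sdpFeasible_symm hC])
    (fun i => by rw [hZ.1.2.2, hC.2.2]; simp)] at hsum
  linarith

/-- Entries lie in `[0, 1]`, so squared errors are at most absolute errors; the loss does not see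
the diagonal, where the membership and cluster matrices differ. -/
lemma loss_le_of_mem_sdpFeasible {n k : ℕ} {Z : Matrix (Fin n) (Fin n) ℝ}
    (hZ : Z ∈ sdpFeasible n) (z : Fin n → Fin k) :
    loss Z (membershipMatrix z) ≤
      1 / (n.choose 2 : ℝ) * ∑ i, ∑ j ∈ Finset.Ioi i, |Z i j - clusterMatrix z i j| := by
  refine mul_le_mul_of_nonneg_left (Finset.sum_le_sum fun i _ => Finset.sum_le_sum fun j hj => ?_)
    (by positivity)
  have hij : i ≠ j := (Finset.mem_Ioi.1 hj).ne
  have hC := clusterMatrix_mem_sdpFeasible z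
  have h : membershipMatrix z i j = clusterMatrix z i j := by
    simp [membershipMatrix, clusterMatrix, hij]
  rw [h, ← sq_abs, pow_two]
  refine mul_le_of_le_one_left (abs_nonneg _) (abs_le.2 ⟨?_, ?_⟩) <;>
  linarith [sdpFeasible_nonneg hZ i j, sdpFeasible_le_one hZ i j, sdpFeasible_nonneg hC i j,
    sdpFeasible_le_one hC i j]

/-! ### Averaging over the graph and the labels -/

lemma integral_clusterMatrix_noise {n k : ℕ} (p q : unitInterval) (z : Fin n → Fin k) :
    ∫ ω, ∑ i, ∑ j, clusterMatrix z i j * noise (connectivityMatrix p q z) ω i j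
      ∂(graphLaw (connectivityMatrix p q z)) = 0 := by
  have h : ∀ ω, ∑ i, ∑ j, clusterMatrix z i j * noise (connectivityMatrix p q z) ω i j =
      2 * ∑ i, ∑ j ∈ Finset.Ioi i,
        clusterMatrix z i j * noise (connectivityMatrix p q z) ω i j := fun ω =>
    sum_sum_eq_two_mul_sum_Ioi
      (fun i j => by
        rw [noise_symm (connectivityMatrix_symm p q z),
          sdpFeasible_symm (clusterMatrix_mem_sdpFeasible z)])
      (fun i => by rw [noise_self (connectivityMatrix_self p q z)]; simp)
  simp only [h]
  rw [integral_const_mul, integral_finsetSum _ fun _ _ => integrable_graphLaw _ _]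
  refine mul_eq_zero_of_right _ (Finset.sum_eq_zero fun i _ => ?_)
  rw [integral_finsetSum _ fun _ _ => integrable_graphLaw _ _]
  refine Finset.sum_eq_zero fun j hj => ?_
  rw [integral_const_mul, integral_noise _ (Finset.mem_Ioi.1 hj), mul_zero]

lemma integral_loss_graphLaw_le {n k : ℕ} {p q : unitInterval} (hn : 2 ≤ n) (hpq : (q : ℝ) < p)
    (z : Fin n → Fin k) {Zhat : Matrix (Fin n) (Fin n) ℝ → Matrix (Fin n) (Fin n) ℝ}
    (hZ : IsSDPEstimator p q Zhat) :
    ∫ ω, loss (Zhat (adjacencyMatrix ω)) (membershipMatrix z)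
      ∂(graphLaw (connectivityMatrix p q z)) ≤
      4 * (Real.log 64 + 8) * (1 / (√n * ((p : ℝ) - q))) := by
  set M := connectivityMatrix p q z with hM
  have hpq' : 0 < (p : ℝ) - q := sub_pos.2 hpq
  have hn2 : (2 : ℝ) ≤ n := by exact_mod_cast hn
  have hch : (n.choose 2 : ℝ) = n * (n - 1) / 2 := Nat.cast_choose_two ℝ n
  have hlog : 0 ≤ Real.log 64 + 8 := by positivity
  have hpt : ∀ ω, loss (Zhat (adjacencyMatrix ω)) (membershipMatrix z) ≤
      1 / (n.choose 2 : ℝ) * (1 / ((p : ℝ) - q)) *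
        (∑ i, ∑ j, Zhat (adjacencyMatrix ω) i j * noise M ω i j -
          ∑ i, ∑ j, clusterMatrix z i j * noise M ω i j) := by
    intro ω
    refine (loss_le_of_mem_sdpFeasible (hZ ω).1 z).trans ?_
    rw [mul_assoc]
    refine mul_le_mul_of_nonneg_left ?_ (by positivity)
    rw [one_div_mul_eq_div, le_div_iff₀' hpq']
    exact (hZ ω).mul_sum_abs_le
  calc _ ≤ ∫ ω, 1 / (n.choose 2 : ℝ) * (1 / ((p : ℝ) - q)) *
        (∑ i, ∑ j, Zhat (adjacencyMatrix ω) i j * noise M ω i j -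
          ∑ i, ∑ j, clusterMatrix z i j * noise M ω i j) ∂(graphLaw M) :=
        integral_mono (integrable_graphLaw M _) (integrable_graphLaw M _) hpt
    _ = 1 / (n.choose 2 : ℝ) * (1 / ((p : ℝ) - q)) *
        ∫ ω, ∑ i, ∑ j, Zhat (adjacencyMatrix ω) i j * noise M ω i j ∂(graphLaw M) := by
      rw [integral_const_mul, integral_sub (integrable_graphLaw M _) (integrable_graphLaw M _), hM,
        integral_clusterMatrix_noise, sub_zero]
    _ ≤ 1 / (n.choose 2 : ℝ) * (1 / ((p : ℝ) - q)) * ((Real.log 64 + 8) * (n * √n)) := by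
      refine mul_le_mul_of_nonneg_left ?_ (by positivity)
      exact integral_inner_noise_le (by omega) (connectivityMatrix_symm p q z)
        (connectivityMatrix_self p q z) (fun ω => (hZ ω).1.1) (fun ω => (hZ ω).1.2.2)
    _ ≤ (4 / n) * (1 / ((p : ℝ) - q)) * ((Real.log 64 + 8) * √n) := by
      -- The left side is `2 / (n - 1)`, and `n ≤ 2 (n - 1)` for `n ≥ 2`.
      have h1 : 1 / (n.choose 2 : ℝ) * n ≤ 4 / n := by
        rw [hch, one_div_mul_eq_div, div_le_div_iff₀ (by nlinarith) (by linarith)]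
        nlinarith
      calc _ = (1 / (n.choose 2 : ℝ) * n) * ((1 / ((p : ℝ) - q)) * ((Real.log 64 + 8) * √n)) := by
            ring
        _ ≤ (4 / n) * ((1 / ((p : ℝ) - q)) * ((Real.log 64 + 8) * √n)) :=
            mul_le_mul_of_nonneg_right h1 (by positivity)
        _ = _ := by ring
    _ = _ := by
      have hs : √(n : ℝ) * √n = n := Real.mul_self_sqrt (by linarith)
      have hs0 : 0 < √(n : ℝ) := by positivity
      rw [← hs]
      simp only [Real.sqrt_mul_self hs0.le]
      field_simp

lemma expectedLoss_le {n k : ℕ} {p q : unitInterval} (hk : 1 ≤ k)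
    {Zhat : Matrix (Fin n) (Fin n) ℝ → Matrix (Fin n) (Fin n) ℝ} {b : ℝ}
    (h : ∀ z : Fin n → Fin k, ∫ ω, loss (Zhat (adjacencyMatrix ω)) (membershipMatrix z)
      ∂(graphLaw (connectivityMatrix p q z)) ≤ b) :
    expectedLoss n k p q Zhat ≤ b := by
  have : Nonempty (Fin k) := ⟨⟨0, hk⟩⟩
  have : IsProbabilityMeasure (uniformOn (Set.univ : Set (Fin k))) :=
    isProbabilityMeasure_uniformOn Set.finite_univ Set.univ_nonempty
  have : IsProbabilityMeasure (labelLaw n k) := by unfold labelLaw; infer_instance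
  have : IsMarkovKernel (Kernel.ofFunOfCountable fun z : Fin n → Fin k =>
      graphLaw (connectivityMatrix p q z)) :=
    ⟨fun z => inferInstanceAs (IsProbabilityMeasure (graphLaw (connectivityMatrix p q z)))⟩
  rw [expectedLoss, sbmLaw, Measure.integral_compProd .of_finite]
  calc _ ≤ ∫ _, b ∂(labelLaw n k) := integral_mono .of_finite .of_finite h
    _ = b := by simp

/-- Here `n.choose 2 = 0`, and division by zero gives the loss the value 0. -/
lemma expectedLoss_eq_zero_of_lt_two {n k : ℕ} {p q : unitInterval} (hn : n < 2)
    {Zhat : Matrix (Fin n) (Fin n) ℝ → Matrix (Fin n) (Fin n) ℝ} :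
    expectedLoss n k p q Zhat = 0 := by
  simp [expectedLoss, loss, Nat.choose_eq_zero_of_lt hn]

/-- The rate of the semidefinite program when the connection probabilities are bounded below. -/
lemma IsSDPEstimator.expectedLoss_le {ε : ℝ} (hε : 0 < ε) {n k : ℕ} {p q : unitInterval}
    (hk : 1 ≤ k) (hq : ε ≤ (q : ℝ)) (hpq : (q : ℝ) < p)
    {Zhat : Matrix (Fin n) (Fin n) ℝ → Matrix (Fin n) (Fin n) ℝ}
    (hZ : IsSDPEstimator p q Zhat) :
    expectedLoss n k p q Zhat ≤
      4 * (Real.log 64 + 8) / √ε * √((p : ℝ) / (n * ((p : ℝ) - q) ^ 2)) := by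
  rcases lt_or_ge n 2 with hn | hn
  · rw [expectedLoss_eq_zero_of_lt_two hn]
    positivity
  · have hpq' : 0 < (p : ℝ) - q := sub_pos.2 hpq
    have hn0 : (0 : ℝ) < n := by exact_mod_cast (by omega : 0 < n)
    refine SBM.expectedLoss_le hk fun z => (integral_loss_graphLaw_le hn hpq z hZ).trans ?_
    rw [Real.sqrt_div p.2.1, Real.sqrt_mul hn0.le, Real.sqrt_sq hpq'.le, div_mul_div_comm,
      mul_one_div, div_le_div_iff₀ (by positivity) (by positivity)]
    -- The lower bound `ε ≤ q < p` inserts the factor `√p / √ε ≥ 1`.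
    have hs : √ε ≤ √(p : ℝ) := Real.sqrt_le_sqrt (by linarith)
    have := mul_le_mul_of_nonneg_left hs
      (by positivity : 0 ≤ 4 * (Real.log 64 + 8) * (√n * ((p : ℝ) - q)))
    linarith

end SBM

theorem mainTheorem9 (ε : ℝ) (hε : 0 < ε) :
    (∃ c : ℝ, 0 < c ∧ ∃ N : ℕ, ∀ (n k : ℕ) (p q : unitInterval),
      N ≤ n → 1 ≤ k → ε ≤ (q : ℝ) → (q : ℝ) < p → (p : ℝ) ≤ 1 - ε →
      ∀ Zhat : Matrix (Fin n) (Fin n) ℝ → Matrix (Fin n) (Fin n) ℝ,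
        SBM.IsSDPEstimator p q Zhat →
        SBM.expectedLoss n k p q Zhat ≤
          c * Real.sqrt ((p : ℝ) / ((n : ℝ) * ((p : ℝ) - q) ^ 2))) ∧
    (∀ δ : ℝ, 0 < δ → ∃ C : ℝ, 0 < C ∧ ∀ (n k : ℕ) (p q : unitInterval),
      1 ≤ k → ε ≤ (q : ℝ) → (q : ℝ) < p → (p : ℝ) ≤ 1 - ε →
      C ≤ (n : ℝ) * ((p : ℝ) - q) ^ 2 / ((p : ℝ) * (k : ℝ) ^ 2) →
      ∀ Zhat : Matrix (Fin n) (Fin n) ℝ → Matrix (Fin n) (Fin n) ℝ,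
        SBM.IsSDPEstimator p q Zhat →
        SBM.expectedLoss n k p q Zhat ≤ δ * (1 / (k : ℝ))) := by
  have hL : 0 < Real.log 64 + 8 := by positivity
  set c : ℝ := 4 * (Real.log 64 + 8) / √ε with hc
  have hc0 : 0 < c := by positivity
  have main : ∀ (n k : ℕ) (p q : unitInterval), 1 ≤ k → ε ≤ (q : ℝ) → (q : ℝ) < p →
      ∀ Zhat : Matrix (Fin n) (Fin n) ℝ → Matrix (Fin n) (Fin n) ℝ,
        SBM.IsSDPEstimator p q Zhat → SBM.expectedLoss n k p q Zhat ≤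
          c * √((p : ℝ) / ((n : ℝ) * ((p : ℝ) - q) ^ 2)) :=
    fun n k p q hk hq hpq Zhat hZ => hZ.expectedLoss_le hε hk hq hpq
  refine ⟨⟨c, hc0, 1, fun n k p q _ hk hq hpq _ => main n k p q hk hq hpq⟩, fun δ hδ =>
    -- The threshold `C` solves `c / (k √C) = δ / k`.
    ⟨(c / δ) ^ 2, by positivity, fun n k p q hk hq hpq _ hC Zhat hZ => ?_⟩⟩
  refine (main n k p q hk hq hpq Zhat hZ).trans ?_
  have hp : 0 < (p : ℝ) := by linarith
  have hk0 : (0 : ℝ) < k := by exact_mod_cast hk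
  rw [← le_div_iff₀' hc0, Real.sqrt_le_left (by positivity)]
  -- The positive threshold in `hC` excludes `n = 0`.
  have hD : 0 < (n : ℝ) * ((p : ℝ) - q) ^ 2 := by
    have h1 : 0 < (n : ℝ) * ((p : ℝ) - q) ^ 2 / ((p : ℝ) * (k : ℝ) ^ 2) :=
      lt_of_lt_of_le (by positivity) hC
    exact (div_pos_iff_of_pos_right (by positivity)).1 h1
  rw [le_div_iff₀ (by positivity)] at hC
  rw [div_le_iff₀ hD]
  calc (p : ℝ) = (δ * (1 / k) / c) ^ 2 * ((c / δ) ^ 2 * (p * k ^ 2)) := by field_simp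
    _ ≤ _ := mul_le_mul_of_nonneg_left hC (by positivity)
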